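/- **Theorem (asymptotic normality of $\widehat\lambda$ for the fractional M/M/1 queue).** Let $0<\alpha\le 1$, $\lambda,\mu>0$, $\theta=\lambda+\mu$ and $p=\lambda/\theta$. Consider the fractional simple birth–death process (M/M/1 queue) of order $\alpha$ with constant birth rate $\lambda$ and death rate $\mu$. That is, its successive inter-event times $S_1,S_2,\dots$ are i.i.d. Mittag-Leffler distributed, $$\Pr\{S_k\ge t\}=E_{\alpha,1}(-\theta t^\alpha),\qquad t\ge 0,\qquad E_{a,b}(x)=\sum_{r\ge 0}\frac{x^r}{\Gamma(ar+b)},$$ equivalently $S_k$ has density $\theta t^{\alpha-1}E_{\alpha,\alpha}(-\theta t^\alpha)$; and, independently of the inter-event times and of each other, the events are births (the state increases by one) with probability $p$ and deaths (the state decreases by one) with probability $1-p$, in every state. (A death event in state $0$ may also be allowed to leave the state at $0$.) From the first $n$ events, let $n_B$ be the number of births, let $\bar L_n=\frac1n\sum_{k=1}^n\ln S_k$ and $\widehat\sigma_n^2=\frac1n\sum_{k=1}^n(\ln S_k-\bar L_n)^2$, and put $$\widehat\alpha=\frac{\pi}{\sqrt{3\left(\widehat\sigma_n^2+\pi^2/6\right)}},\qquad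 \widehat\theta=\exp\left(-\widehat\alpha\,(\bar L_n+\gamma)\right),\qquad \widehat\lambda=\frac{n_B}{n}\,\widehat\theta,$$ where $\gamma$ is the Euler–Mascheroni constant. Then, as $n\to\infty$, $$\sqrt n\,(\widehat\lambda-\lambda)\ \xrightarrow{\ d\ }\ N\left(0,\ \theta^2p(1-p)+p^2\sigma_\theta^2\right),$$ where $$\sigma_\theta^2=\frac{\theta^2\left[20\pi^4(2-\alpha^2)-3\pi^2(\alpha^4+20\alpha^2-32)(\ln\theta)^2-720\,\alpha^3(\ln\theta)\,\zeta(3)\right]}{120\pi^2}\ \ge\ 0$$ and $\zeta(3)$ is the value of the Riemann zeta function at $3$. -/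

import Mathlib

open MeasureTheory ProbabilityTheory Filter

noncomputable section

/-- The two-parameter Mittag-Leffler function `E_{a,b}(x) = ∑ r, x ^ r / Γ(a r + b)`. -/
def mittagLeffler (a b x : ℝ) : ℝ := ∑' r : ℕ, x ^ r / Real.Gamma (a * r + b)

/-- `T` is Mittag-Leffler distributed with order `α` and rate `θ`:
`Pr {T ≥ t} = E_{α,1}(-θ t ^ α)` for all `t ≥ 0`. -/
def IsMittagLefflerTime {Ω : Type*} [MeasurableSpace Ω] (P : Measure Ω) (α θ : ℝ)
    (T : Ω → ℝ) : Prop :=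
  ∀ t : ℝ, 0 ≤ t → P.real {ω | t ≤ T ω} = mittagLeffler α 1 (-θ * t ^ α)

/-- The time of the `k`-th event, when `S 0, S 1, …` are the successive inter-event times. -/
def eventTime {Ω : Type*} (S : ℕ → Ω → ℝ) (k : ℕ) (ω : Ω) : ℝ :=
  ∑ j ∈ Finset.range k, S j ω

/-- `1` if the event number `k + 1`, which takes the state from `X k` to `X (k + 1)`, is a birth
(arrival), and `0` if it is a death (departure). -/
def birth {Ω : Type*} (X : ℕ → Ω → ℤ) (k : ℕ) (ω : Ω) : ℕ :=
  if X (k + 1) ω = X k ω + 1 then 1 else 0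

/-- The constant-rate fractional birth-death (M/M/1) process `N` of order `α` with birth rate
`lam`, death rate `mu` and initial state `i`, together with its inter-event times `S k` and its
embedded chain `X k` (the state between the `k`-th and the `(k + 1)`-st event).
The inter-event times are i.i.d. Mittag-Leffler of order `α` and rate `lam + mu`. Independently of
them and of each other, the events are births with probability `lam / (lam + mu)` and deaths
otherwise. A birth raises the state by one; a death lowers it by one, except that a death in
state `0` may also leave the state at `0`, so that both the process on `ℤ` and the queue on `ℕ`
whose server also completes (void) services while it is empty are included. -/
structure IsFractionalQueue {Ω : Type*} [MeasurableSpace Ω] (P : Measure Ω) (α lam mu : ℝ)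
    (i : ℕ) (N : ℝ → Ω → ℤ) (S : ℕ → Ω → ℝ) (X : ℕ → Ω → ℤ) : Prop where
  measurable_time : ∀ k, Measurable (S k)
  measurable_state : ∀ k, Measurable (X k)
  init : ∀ᵐ ω ∂P, X 0 ω = i
  path : ∀ᵐ ω ∂P, ∀ (k : ℕ) (t : ℝ),
    eventTime S k ω ≤ t → t < eventTime S (k + 1) ω → N t ω = X k ω
  death : ∀ᵐ ω ∂P, ∀ k : ℕ, birth X k ω = 0 →
    X (k + 1) ω = X k ω - 1 ∨ (X k ω = 0 ∧ X (k + 1) ω = 0)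
  time_law : ∀ k, IsMittagLefflerTime P α (lam + mu) (S k)
  time_indep : iIndepFun S P
  birth_law : ∀ k, P.real {ω | birth X k ω = 1} = lam / (lam + mu)
  birth_indep : iIndepFun (birth X) P
  time_birth_indep : IndepFun (fun ω k => S k ω) (fun ω k => birth X k ω) P

/-- The sample mean of `ln S` over the first `n` inter-event times. -/
def logMean {Ω : Type*} (S : ℕ → Ω → ℝ) (n : ℕ) (ω : Ω) : ℝ :=
  (∑ k ∈ Finset.range n, Real.log (S k ω)) / n

/-- The sample variance of `ln S` over the first `n` inter-event times. -/
def logVar {Ω : Type*} (S : ℕ → Ω → ℝ) (n : ℕ) (ω : Ω) : ℝ :=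
  (∑ k ∈ Finset.range n, (Real.log (S k ω) - logMean S n ω) ^ 2) / n

/-- The method-of-moments estimator of `α`. -/
def alphaHat {Ω : Type*} (S : ℕ → Ω → ℝ) (n : ℕ) (ω : Ω) : ℝ :=
  Real.pi / Real.sqrt (3 * (logVar S n ω + Real.pi ^ 2 / 6))

/-- The method-of-moments estimator of `θ`, the sum of the birth and death rates. -/
def thetaHat {Ω : Type*} (S : ℕ → Ω → ℝ) (n : ℕ) (ω : Ω) : ℝ :=
  Real.exp (-alphaHat S n ω * (logMean S n ω + Real.eulerMascheroniConstant))

/-- The number of births among the first `n` events. -/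
def numBirths {Ω : Type*} (X : ℕ → Ω → ℤ) (n : ℕ) (ω : Ω) : ℕ :=
  ∑ k ∈ Finset.range n, birth X k ω

/-- The estimator of the birth rate: the proportion of births times the estimator of `θ`. -/
def lambdaHat {Ω : Type*} (S : ℕ → Ω → ℝ) (X : ℕ → Ω → ℤ) (n : ℕ) (ω : Ω) : ℝ :=
  (numBirths X n ω : ℝ) / n * thetaHat S n ω

/-- The asymptotic variance `σ_θ²` of the estimator of `θ`. -/
def sigmaThetaSq (α θ : ℝ) : ℝ :=
  θ ^ 2 * (20 * Real.pi ^ 4 * (2 - α ^ 2)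
      - 3 * Real.pi ^ 2 * (α ^ 4 + 20 * α ^ 2 - 32) * Real.log θ ^ 2
      - 720 * α ^ 3 * Real.log θ * (riemannZeta 3).re) / (120 * Real.pi ^ 2)

end

open scoped Topology ENNReal NNReal Asymptotics

lemma integral_exp_mul_mittagLeffler {α θ s : ℝ} (hα : 0 < α) (hθ : 0 < θ) (hs : 0 < s)
    (hθs : θ < s ^ α) :
    ∫ t in Set.Ioi (0 : ℝ), Real.exp (-(s * t)) * mittagLeffler α 1 (-θ * t ^ α)
      = s⁻¹ * (1 - -(θ / s ^ α))⁻¹ := by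
  have hsα : 0 < s ^ α := Real.rpow_pos_of_pos hs α
  have hterm : ∀ (c : ℝ) (r : ℕ), ∫ t in Set.Ioi (0 : ℝ),
      c ^ r / Real.Gamma (α * r + 1) * (t ^ (α * r + 1 - 1) * Real.exp (-(s * t)))
      = s⁻¹ * (c / s ^ α) ^ r := by
    intro c r
    have hG : Real.Gamma (α * r + 1) ≠ 0 := (Real.Gamma_pos_of_pos (by positivity)).ne'
    rw [integral_const_mul, Real.integral_rpow_mul_exp_neg_mul_Ioi (by positivity) hs,
      Real.rpow_add (by positivity), Real.rpow_one, one_div, Real.inv_rpow hs.le,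
      Real.rpow_mul hs.le, Real.rpow_natCast, div_pow]
    field_simp
  have hint : ∀ (c : ℝ) (r : ℕ), IntegrableOn (fun t : ℝ =>
      c ^ r / Real.Gamma (α * r + 1) * (t ^ (α * r + 1 - 1) * Real.exp (-(s * t))))
      (Set.Ioi 0) := by
    intro c r
    refine Integrable.const_mul ?_ _
    have := integrableOn_rpow_mul_exp_neg_mul_rpow (s := α * r + 1 - 1) (p := 1) (b := s)
      (by have : 0 ≤ α * r := by positivity
          linarith) one_pos hs
    simpa [neg_mul, IntegrableOn] using this
  have hnorm : ∀ r : ℕ, ∫ t in Set.Ioi (0 : ℝ),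
      ‖(-θ) ^ r / Real.Gamma (α * r + 1) * (t ^ (α * r + 1 - 1) * Real.exp (-(s * t)))‖
      = s⁻¹ * (θ / s ^ α) ^ r := by
    intro r
    rw [← hterm]
    refine setIntegral_congr_fun measurableSet_Ioi fun t ht => ?_
    have ht : 0 < t := ht
    have hG : 0 < Real.Gamma (α * r + 1) := Real.Gamma_pos_of_pos (by positivity)
    simp only [norm_mul, norm_div, norm_pow, norm_neg, Real.norm_eq_abs, abs_of_pos hG,
      abs_of_pos hθ, abs_of_pos (Real.exp_pos _), abs_of_pos (Real.rpow_pos_of_pos ht _)]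
  have hlt : θ / s ^ α < 1 := (div_lt_one hsα).2 hθs
  have hsum := hasSum_integral_of_summable_integral_norm (fun r => hint (-θ) r) (by
    simp_rw [hnorm]
    exact (summable_geometric_of_lt_one (by positivity) hlt).mul_left _)
  have hgeo := (hasSum_geometric_of_abs_lt_one (r := -(θ / s ^ α))
    (by rwa [abs_neg, abs_of_pos (by positivity)])).mul_left s⁻¹
  simp_rw [hterm, neg_div] at hsum
  rw [← hsum.unique hgeo]
  refine setIntegral_congr_fun measurableSet_Ioi fun t ht => ?_
  have ht : 0 < t := ht
  simp only [mittagLeffler]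
  rw [← tsum_mul_left]
  refine tsum_congr fun r => ?_
  rw [add_sub_cancel_right, mul_pow, Real.rpow_mul ht.le, Real.rpow_natCast]
  ring

section
variable {Ω : Type*} [MeasurableSpace Ω] {P : Measure Ω} [IsProbabilityMeasure P] {T : Ω → ℝ}
  {α θ : ℝ}

lemma IsMittagLefflerTime.ae_nonneg (h : IsMittagLefflerTime P α θ T) (hα : 0 < α)
    (hT : Measurable T) : 0 ≤ᵐ[P] T := by
  have h0 := h 0 le_rfl
  have h1 : mittagLeffler α 1 (-θ * (0 : ℝ) ^ α) = 1 := by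
    rw [Real.zero_rpow hα.ne', mul_zero, mittagLeffler, tsum_eq_single 0]
    · simp
    · intro r hr
      simp [hr]
  rw [h1] at h0
  exact (mem_ae_iff_prob_eq_one₀ (measurableSet_le measurable_const hT).nullMeasurableSet).2
    ((ENNReal.toReal_eq_one_iff _).1 h0)

lemma integral_exp_mul_measureReal_le (hT : Measurable T) (hT0 : 0 ≤ᵐ[P] T) {s : ℝ}
    (hs : 0 < s) :
    ∫ t in Set.Ioi (0 : ℝ), Real.exp (-(s * t)) * P.real {ω | t ≤ T ω}
      = s⁻¹ * (1 - mgf T P (-s)) := by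
  have hint : ∀ x, ∫ t in (0 : ℝ)..x, Real.exp (-(s * t)) = s⁻¹ * (1 - Real.exp (-s * x)) := by
    intro x
    have := intervalIntegral.integral_comp_mul_left (fun u => Real.exp u) (a := 0) (b := x)
      (neg_ne_zero.2 hs.ne')
    simp only [neg_mul] at this
    rw [this]
    simp
    ring
  have key := lintegral_comp_eq_lintegral_meas_le_mul P hT0 hT.aemeasurable
    (g := fun t => Real.exp (-(s * t)))
    (fun t _ => (by fun_prop : Continuous fun t => Real.exp (-(s * t))).intervalIntegrable _ _)
    (ae_of_all _ fun t => (Real.exp_pos _).le)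
  simp only [hint] at key
  have hnn : 0 ≤ᵐ[P] fun ω => s⁻¹ * (1 - Real.exp (-s * T ω)) := by
    filter_upwards [hT0] with ω hω
    have : Real.exp (-s * T ω) ≤ 1 := Real.exp_le_one_iff.2 (by
      have := mul_nonneg hs.le hω
      linarith)
    exact mul_nonneg (by positivity) (by linarith)
  have hie : Integrable (fun ω => Real.exp (-s * T ω)) P := by
    refine Integrable.of_bound (by fun_prop) 1 ?_
    filter_upwards [hT0] with ω hω
    rw [Real.norm_eq_abs, abs_of_pos (Real.exp_pos _), Real.exp_le_one_iff]
    have := mul_nonneg hs.le hω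
    linarith
  have h1 : ∫ ω, s⁻¹ * (1 - Real.exp (-s * T ω)) ∂P = s⁻¹ * (1 - mgf T P (-s)) := by
    rw [integral_const_mul, integral_sub (by simp) hie]
    simp [mgf]
  have hanti : Antitone fun t => P.real {ω | t ≤ T ω} := fun a b hab =>
    measureReal_mono fun ω hω => hab.trans hω
  rw [← h1, integral_eq_lintegral_of_nonneg_ae hnn (by fun_prop), key,
    integral_eq_lintegral_of_nonneg_ae (ae_of_all _ fun t => by positivity)
      (by have := hanti.measurable; fun_prop)]
  congr 1
  refine lintegral_congr fun t => ?_
  rw [ENNReal.ofReal_mul (Real.exp_pos _).le, ofReal_measureReal, mul_comm]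

lemma integrable_exp_mul_of_nonpos (hT : Measurable T) (hT0 : 0 ≤ᵐ[P] T) {s : ℝ} (hs : s ≤ 0) :
    Integrable (fun ω => Real.exp (s * T ω)) P := by
  refine Integrable.of_bound (by fun_prop) 1 ?_
  filter_upwards [hT0] with ω hω
  rw [Real.norm_eq_abs, abs_of_pos (Real.exp_pos _), Real.exp_le_one_iff]
  exact mul_nonpos_of_nonpos_of_nonneg hs hω

/-- The Laplace transform of the Mittag-Leffler distribution. -/
lemma IsMittagLefflerTime.mgf_neg (h : IsMittagLefflerTime P α θ T) (hα : 0 < α) (hθ : 0 < θ)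
    (hT : Measurable T) {s : ℝ} (hs : 0 < s) : mgf T P (-s) = θ / (θ + s ^ α) := by
  have hT0 := h.ae_nonneg hα hT
  have hlarge : ∀ s : ℝ, 0 < s → θ < s ^ α → mgf T P (-s) = θ / (θ + s ^ α) := by
    intro s hs hθs
    have hsα : 0 < s ^ α := Real.rpow_pos_of_pos hs α
    have h1 := integral_exp_mul_measureReal_le (P := P) hT hT0 hs
    rw [setIntegral_congr_fun measurableSet_Ioi fun t (ht : 0 < t) => by
      show _ = Real.exp (-(s * t)) * mittagLeffler α 1 (-θ * t ^ α)
      rw [h t ht.le], integral_exp_mul_mittagLeffler hα hθ hs hθs] at h1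
    have h2 := mul_left_cancel₀ (inv_ne_zero hs.ne') h1
    have h3 : mgf T P (-s) = 1 - (1 - -(θ / s ^ α))⁻¹ := by linarith
    rw [h3]
    have : s ^ α + θ ≠ 0 := by positivity
    have : θ + s ^ α ≠ 0 := by positivity
    have h5 : (1 - -(θ / s ^ α)) = (s ^ α + θ) / s ^ α := by field_simp; ring
    rw [h5]
    field_simp
    ring
  have hset : Set.Iio (0 : ℝ) ⊆ interior (integrableExpSet T P) :=
    interior_maximal (fun s hs => integrable_exp_mul_of_nonpos hT hT0 (le_of_lt hs)) isOpen_Iio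
  have hF : AnalyticOnNhd ℝ (fun s => mgf T P (-s)) (Set.Ioi 0) := fun s hs =>
    (analyticAt_mgf (hset (by simpa using hs))).fun_comp analyticAt_id.neg
  have hG : AnalyticOnNhd ℝ (fun s : ℝ => θ / (θ + s ^ α)) (Set.Ioi 0) := fun s hs => by
    have hs : 0 < s := hs
    exact analyticAt_const.div (analyticAt_const.add 
      (Real.contDiffAt_rpow_const_of_ne hs.ne').analyticAt)
      (by positivity)
  obtain ⟨s₀, hs₀, hs₀'⟩ : ∃ s₀ : ℝ, 0 < s₀ ∧ θ < s₀ ^ α :=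
    ((eventually_gt_atTop 0).and ((tendsto_rpow_atTop hα).eventually_gt_atTop θ)).exists
  refine hF.eqOn_of_preconnected_of_eventuallyEq hG isPreconnected_Ioi hs₀ ?_ hs
  filter_upwards [lt_mem_nhds hs₀, (Real.continuousAt_rpow_const s₀ α (Or.inl hs₀.ne')).eventually
    (lt_mem_nhds hs₀')] with s h1 h2 using hlarge s h1 h2

lemma IsMittagLefflerTime.ae_pos (h : IsMittagLefflerTime P α θ T) (hα : 0 < α) (hθ : 0 < θ)
    (hT : Measurable T) : ∀ᵐ ω ∂P, 0 < T ω := by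
  have hT0 := h.ae_nonneg hα hT
  have hle : ∀ s : ℝ, 0 < s → P.real {ω | T ω ≤ 0} ≤ θ / (θ + s ^ α) := by
    intro s hs
    have hm : MeasurableSet {ω | T ω ≤ 0} := measurableSet_le hT measurable_const
    rw [← h.mgf_neg hα hθ hT hs, ← integral_indicator_one hm]
    refine integral_mono_ae ((integrable_const 1).indicator hm)
      (integrable_exp_mul_of_nonpos hT hT0 (by linarith)) ?_
    filter_upwards [hT0] with ω hω
    by_cases h0 : T ω ≤ 0
    · have : T ω = 0 := le_antisymm h0 hω
      simp [this]
    · simp [h0, (Real.exp_pos _).le]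
  have hlim : Tendsto (fun s : ℝ => θ / (θ + s ^ α)) atTop (𝓝 0) :=
    tendsto_const_nhds.div_atTop (tendsto_atTop_add_const_left _ _ (tendsto_rpow_atTop hα))
  have h0 : P.real {ω | T ω ≤ 0} = 0 :=
    le_antisymm (ge_of_tendsto hlim ((eventually_gt_atTop 0).mono hle)) measureReal_nonneg
  rw [measureReal_eq_zero_iff] at h0
  rw [ae_iff]
  simpa using h0

end

lemma lintegral_rpow_mul_exp_neg_mul_Ioi {a r : ℝ} (ha : 0 < a) (hr : 0 < r) :
    ∫⁻ x in Set.Ioi (0 : ℝ), ENNReal.ofReal (x ^ (a - 1) * Real.exp (-(r * x)))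
      = ENNReal.ofReal (r ^ (-a) * Real.Gamma a) := by
  have hint : IntegrableOn (fun x : ℝ => x ^ (a - 1) * Real.exp (-(r * x))) (Set.Ioi 0) := by
    have := integrableOn_rpow_mul_exp_neg_mul_rpow (s := a - 1) (p := 1) (b := r)
      (by linarith) one_pos hr
    simpa [neg_mul, IntegrableOn] using this
  rw [← ofReal_integral_eq_lintegral_ofReal hint, Real.integral_rpow_mul_exp_neg_mul_Ioi ha hr,
    one_div, Real.inv_rpow hr.le, Real.rpow_neg hr.le]
  filter_upwards [ae_restrict_mem measurableSet_Ioi] with x hx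
  have hx : 0 < x := hx
  positivity

lemma lintegral_rpow_div_add_Ioi {a θ : ℝ} (ha : 0 < a) (ha1 : a < 1) (hθ : 0 < θ) :
    ∫⁻ u in Set.Ioi (0 : ℝ), ENNReal.ofReal (u ^ (a - 1) / (θ + u))
      = ENNReal.ofReal (θ ^ (a - 1) * (Real.Gamma a * Real.Gamma (1 - a))) := by
  calc
    _ = ∫⁻ u in Set.Ioi (0 : ℝ), ∫⁻ y in Set.Ioi (0 : ℝ),
          ENNReal.ofReal (u ^ (a - 1) * Real.exp (-((θ + u) * y))) := by
        refine setLIntegral_congr_fun measurableSet_Ioi fun u hu => ?_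
        have hu : 0 < u := hu
        have h1 := lintegral_rpow_mul_exp_neg_mul_Ioi one_pos (add_pos hθ hu)
        simp only [sub_self, Real.rpow_zero, one_mul, Real.Gamma_one, mul_one] at h1
        simp_rw [ENNReal.ofReal_mul (Real.rpow_nonneg hu.le (a - 1))]
        rw [lintegral_const_mul _ (by fun_prop), h1, Real.rpow_neg_one,
          ← ENNReal.ofReal_mul (by positivity), div_eq_mul_inv]
    _ = ∫⁻ y in Set.Ioi (0 : ℝ), ∫⁻ u in Set.Ioi (0 : ℝ),
          ENNReal.ofReal (u ^ (a - 1) * Real.exp (-((θ + u) * y))) := by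
        rw [lintegral_lintegral_swap]
        fun_prop
    _ = ∫⁻ y in Set.Ioi (0 : ℝ), ENNReal.ofReal (Real.Gamma a) *
          ENNReal.ofReal (y ^ ((1 - a) - 1) * Real.exp (-(θ * y))) := by
        refine setLIntegral_congr_fun measurableSet_Ioi fun y hy => ?_
        have hy : 0 < y := hy
        have h1 := lintegral_rpow_mul_exp_neg_mul_Ioi ha hy
        have h2 : ∀ u : ℝ, u ^ (a - 1) * Real.exp (-((θ + u) * y))
            = Real.exp (-(θ * y)) * (u ^ (a - 1) * Real.exp (-(y * u))) := by
          intro u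
          rw [show -((θ + u) * y) = -(θ * y) + -(y * u) by ring, Real.exp_add]
          ring
        simp_rw [h2, ENNReal.ofReal_mul (Real.exp_pos (-(θ * y))).le]
        rw [lintegral_const_mul _ (by fun_prop), h1, ← ENNReal.ofReal_mul (by positivity),
          ← ENNReal.ofReal_mul (Real.Gamma_pos_of_pos ha).le,
          show (1 - a) - 1 = -a by ring]
        congr 1
        ring
    _ = _ := by
        rw [lintegral_const_mul _ (by fun_prop),
          lintegral_rpow_mul_exp_neg_mul_Ioi (by linarith) hθ,
          ← ENNReal.ofReal_mul (Real.Gamma_pos_of_pos ha).le, neg_sub]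
        congr 1
        ring

lemma lintegral_rpow_div_add_rpow_Ioi {α θ s : ℝ} (hα : 0 < α) (hθ : 0 < θ) (hs : 0 < s)
    (hsα : s < α) :
    ∫⁻ x in Set.Ioi (0 : ℝ), ENNReal.ofReal (x ^ (s - 1) / (θ + x ^ α))
      = ENNReal.ofReal (θ ^ (s / α - 1) *
          (Real.Gamma (s / α) * Real.Gamma (1 - s / α)) / α) := by
  have ha : 0 < s / α := by positivity
  have ha1 : s / α < 1 := (div_lt_one hα).2 hsα
  set g : ℝ → ℝ := fun u => u ^ (s / α - 1) / (θ + u) with hg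
  have hgm : Measurable g := by fun_prop
  have hg0 : 0 ≤ᵐ[volume.restrict (Set.Ioi 0)] g := by
    filter_upwards [ae_restrict_mem measurableSet_Ioi] with x hx
    have hx : 0 < x := hx
    simp only [hg, Pi.zero_apply]
    positivity
  have hB := lintegral_rpow_div_add_Ioi ha ha1 hθ
  have hΓ : 0 < Real.Gamma (s / α) * Real.Gamma (1 - s / α) :=
    mul_pos (Real.Gamma_pos_of_pos ha) (Real.Gamma_pos_of_pos (by linarith))
  have hgi : IntegrableOn g (Set.Ioi 0) :=
    ⟨hgm.aestronglyMeasurable, by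
      rw [hasFiniteIntegral_iff_ofReal hg0, hB]
      exact ENNReal.ofReal_lt_top⟩
  have hgv : ∫ u in Set.Ioi (0 : ℝ), g u
      = θ ^ (s / α - 1) * (Real.Gamma (s / α) * Real.Gamma (1 - s / α)) := by
    rw [integral_eq_lintegral_of_nonneg_ae hg0 hgm.aestronglyMeasurable, hB,
      ENNReal.toReal_ofReal (by positivity)]
  have hpt : ∀ x ∈ Set.Ioi (0 : ℝ), x ^ (s - 1) / (θ + x ^ α)
      = α⁻¹ * ((α * x ^ (α - 1)) • g (x ^ α)) := by
    intro x hx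
    have hx : 0 < x := hx
    simp only [hg, smul_eq_mul]
    rw [← Real.rpow_mul hx.le, show α * (s / α - 1) = s - α by field_simp,
      show s - 1 = (α - 1) + (s - α) by ring, Real.rpow_add hx]
    field_simp
  have hfi : IntegrableOn (fun x : ℝ => α⁻¹ * ((α * x ^ (α - 1)) • g (x ^ α))) (Set.Ioi 0) := by
    have h1 := (integrableOn_Ioi_comp_rpow_iff g hα.ne').2 hgi
    rw [abs_of_pos hα] at h1
    exact h1.const_mul _
  rw [setLIntegral_congr_fun measurableSet_Ioi fun x hx => by rw [hpt x hx],
    ← ofReal_integral_eq_lintegral_ofReal hfi, integral_const_mul,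
    integral_comp_rpow_Ioi_of_pos hα, hgv]
  · congr 1
    ring
  · filter_upwards [ae_restrict_mem measurableSet_Ioi] with x hx
    rw [← hpt x hx]
    have hx : 0 < x := hx
    simp only [Pi.zero_apply]
    positivity

section
variable {Ω : Type*} [MeasurableSpace Ω] {P : Measure Ω} [IsProbabilityMeasure P] {T : Ω → ℝ}
  {α θ : ℝ}

lemma IsMittagLefflerTime.lintegral_rpow_neg (h : IsMittagLefflerTime P α θ T) (hα : 0 < α)
    (hθ : 0 < θ) (hT : Measurable T) {s : ℝ} (hs : 0 < s) (hsα : s < α) :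
    ∫⁻ ω, ENNReal.ofReal (T ω ^ (-s)) ∂P = ENNReal.ofReal (θ ^ (s / α) *
      Real.Gamma (1 + s / α) * Real.Gamma (1 - s / α) / Real.Gamma (1 + s)) := by
  have hΓ := Real.Gamma_pos_of_pos hs
  have key : (∫⁻ ω, ENNReal.ofReal (T ω ^ (-s)) ∂P) * ENNReal.ofReal (Real.Gamma s)
      = ENNReal.ofReal θ * ENNReal.ofReal (θ ^ (s / α - 1) *
          (Real.Gamma (s / α) * Real.Gamma (1 - s / α)) / α) := by
    calc
      _ = ∫⁻ ω, (∫⁻ x in Set.Ioi (0 : ℝ),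
            ENNReal.ofReal (x ^ (s - 1) * Real.exp (-(T ω * x)))) ∂P := by
          rw [← lintegral_mul_const _ (by fun_prop)]
          refine lintegral_congr_ae ?_
          filter_upwards [h.ae_pos hα hθ hT] with ω hω
          rw [lintegral_rpow_mul_exp_neg_mul_Ioi hs hω, ENNReal.ofReal_mul (by positivity)]
      _ = ∫⁻ x in Set.Ioi (0 : ℝ), ∫⁻ ω,
            ENNReal.ofReal (x ^ (s - 1) * Real.exp (-(T ω * x))) ∂P := by
          rw [lintegral_lintegral_swap]
          fun_prop
      _ = ∫⁻ x in Set.Ioi (0 : ℝ), ENNReal.ofReal θ *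
            ENNReal.ofReal (x ^ (s - 1) / (θ + x ^ α)) := by
          refine setLIntegral_congr_fun measurableSet_Ioi fun x hx => ?_
          have hx : 0 < x := hx
          have h1 := h.mgf_neg hα hθ hT hx
          simp_rw [ENNReal.ofReal_mul (Real.rpow_nonneg hx.le (s - 1))]
          rw [lintegral_const_mul _ (by fun_prop)]
          have h2 : ∫⁻ ω, ENNReal.ofReal (Real.exp (-(T ω * x))) ∂P
              = ENNReal.ofReal (mgf T P (-x)) := by
            have := ofReal_integral_eq_lintegral_ofReal
              (integrable_exp_mul_of_nonpos hT (h.ae_nonneg hα hT) (neg_nonpos.2 hx.le))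
              (ae_of_all _ fun ω => (Real.exp_pos _).le)
            rw [mgf, this]
            simp [mul_comm]
          rw [h2, h1, ← ENNReal.ofReal_mul (by positivity), ← ENNReal.ofReal_mul hθ.le]
          congr 1
          ring
      _ = _ := by
          rw [lintegral_const_mul _ (by fun_prop), lintegral_rpow_div_add_rpow_Ioi hα hθ hs hsα]
  refine (ENNReal.mul_left_inj (by simpa using hΓ) ENNReal.ofReal_ne_top).1 (key.trans ?_)
  have hΓ1 : 0 < Real.Gamma (1 - s / α) :=
    Real.Gamma_pos_of_pos (sub_pos.2 ((div_lt_one hα).2 hsα))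
  have hΓ2 : 0 < Real.Gamma (1 + s / α) := Real.Gamma_pos_of_pos (by positivity)
  have hΓ3 : 0 < Real.Gamma (1 + s) := Real.Gamma_pos_of_pos (by positivity)
  rw [← ENNReal.ofReal_mul hθ.le, ← ENNReal.ofReal_mul (by positivity)]
  congr 1
  rw [add_comm 1 s, add_comm 1 (s / α), Real.Gamma_add_one hs.ne',
    Real.Gamma_add_one (by positivity), Real.rpow_sub_one hθ.ne']
  field_simp

lemma IsMittagLefflerTime.lintegral_rpow_lt_top (h : IsMittagLefflerTime P α θ T) (hα : 0 < α)
    (hθ : 0 < θ) (hT : Measurable T) {s : ℝ} (hs : 0 < s) (hsα : s < α) :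
    ∫⁻ ω, ENNReal.ofReal (T ω ^ s) ∂P < ∞ := by
  have he : 0 < 1 - Real.exp (-1) := by
    have : Real.exp (-1) < 1 := by simp
    linarith
  have hlow : ∀ᵐ ω ∂P, ENNReal.ofReal ((1 - Real.exp (-1)) / s) * ENNReal.ofReal (T ω ^ s)
      ≤ ∫⁻ x in Set.Ioi (0 : ℝ), ENNReal.ofReal (x ^ (-s - 1) * (1 - Real.exp (-(x * T ω)))) := by
    filter_upwards [h.ae_pos hα hθ hT] with ω hω
    have hi : 0 < (T ω)⁻¹ := by positivity
    have h1 : ENNReal.ofReal (T ω ^ s / s)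
        = ∫⁻ x in Set.Ioi (T ω)⁻¹, ENNReal.ofReal (x ^ (-s - 1)) := by
      rw [← ofReal_integral_eq_lintegral_ofReal
        (integrableOn_Ioi_rpow_of_lt (by linarith) hi), integral_Ioi_rpow_of_lt (by linarith) hi]
      · congr 1
        rw [sub_add_cancel, Real.inv_rpow hω.le, Real.rpow_neg hω.le]
        field_simp
      · filter_upwards [ae_restrict_mem measurableSet_Ioi] with x hx
        exact Real.rpow_nonneg (hi.trans hx).le _
    calc
      _ = ENNReal.ofReal (1 - Real.exp (-1)) * ENNReal.ofReal (T ω ^ s / s) := by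
          rw [← ENNReal.ofReal_mul (by positivity), ← ENNReal.ofReal_mul he.le]
          congr 1
          ring
      _ = ∫⁻ x in Set.Ioi (T ω)⁻¹, ENNReal.ofReal (1 - Real.exp (-1)) *
            ENNReal.ofReal (x ^ (-s - 1)) := by
          rw [h1, lintegral_const_mul _ (by fun_prop)]
      _ ≤ ∫⁻ x in Set.Ioi (T ω)⁻¹,
            ENNReal.ofReal (x ^ (-s - 1) * (1 - Real.exp (-(x * T ω)))) := by
          refine setLIntegral_mono' measurableSet_Ioi fun x hx => ?_
          have hx : (T ω)⁻¹ < x := hx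
          rw [← ENNReal.ofReal_mul he.le, mul_comm]
          refine ENNReal.ofReal_le_ofReal (mul_le_mul_of_nonneg_left ?_
            (Real.rpow_nonneg (hi.trans hx).le _))
          have : 1 < x * T ω := (inv_lt_iff_one_lt_mul₀ hω).1 hx
          have := Real.exp_le_exp.2 (show -(x * T ω) ≤ -1 by linarith)
          linarith
      _ ≤ _ := lintegral_mono_set (Set.Ioi_subset_Ioi hi.le)
  have hup : ∫⁻ ω, (∫⁻ x in Set.Ioi (0 : ℝ),
      ENNReal.ofReal (x ^ (-s - 1) * (1 - Real.exp (-(x * T ω))))) ∂P < ∞ := by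
    rw [lintegral_lintegral_swap (by fun_prop)]
    refine lt_of_eq_of_lt (setLIntegral_congr_fun measurableSet_Ioi fun x hx => ?_)
      (lt_of_eq_of_lt (lintegral_rpow_div_add_rpow_Ioi hα hθ (sub_pos.2 hsα) (by linarith))
        ENNReal.ofReal_lt_top)
    have hx : 0 < x := hx
    have hT0 := h.ae_nonneg hα hT
    have hie := integrable_exp_mul_of_nonpos hT hT0 (neg_nonpos.2 hx.le)
    have h1 := h.mgf_neg hα hθ hT hx
    have h2 := ofReal_integral_eq_lintegral_ofReal (f := fun ω => 1 - Real.exp (-x * T ω)) (μ := P)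
      ((integrable_const 1).sub hie) (by
        filter_upwards [hT0] with ω hω
        have : Real.exp (-x * T ω) ≤ 1 := Real.exp_le_one_iff.2
          (mul_nonpos_of_nonpos_of_nonneg (neg_nonpos.2 hx.le) hω)
        simpa using this)
    rw [integral_sub (integrable_const 1) hie] at h2
    change ENNReal.ofReal (_ - mgf T P (-x)) = _ at h2
    simp_rw [ENNReal.ofReal_mul (Real.rpow_nonneg hx.le (-s - 1))]
    rw [lintegral_const_mul _ (by fun_prop)]
    simp_rw [← neg_mul]
    rw [← h2, h1, ← ENNReal.ofReal_mul (by positivity)]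
    congr 1
    simp only [integral_const, probReal_univ, smul_eq_mul, mul_one]
    rw [show α - s - 1 = (-s - 1) + α by ring, Real.rpow_add hx]
    have : θ + x ^ α ≠ 0 := by positivity
    field_simp
    ring
  have h3 := (lintegral_mono_ae hlow).trans_lt hup
  rw [lintegral_const_mul _ (by fun_prop)] at h3
  exact ENNReal.lt_top_of_mul_ne_top_right h3.ne (by simpa using div_pos he hs)

end

lemma abs_log_one_sub_add_le {x : ℝ} (hx : |x| ≤ 1 / 2) :
    |-Real.log (1 - x) - x - (x ^ 2 / 2 + x ^ 3 / 3 + x ^ 4 / 4)| ≤ 2 * |x| ^ 5 := by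
  have h := Real.abs_log_sub_add_sum_range_le (show |x| < 1 by linarith) 4
  simp only [Finset.sum_range_succ, Finset.sum_range_zero] at h
  rw [← abs_neg] at h
  norm_num at h
  have h2 : |x| ^ 5 / (1 - |x|) ≤ 2 * |x| ^ 5 := by
    rw [div_le_iff₀ (by linarith)]
    nlinarith [pow_nonneg (abs_nonneg x) 5]
  refine le_trans (le_of_eq ?_) (h.trans h2)
  congr 1
  ring

/-- The Weierstrass-type expansion of `log Γ(1 - s)`. -/
lemma tendsto_log_Gamma_one_sub {s : ℝ} (hs : s < 1) :
    Tendsto (fun n : ℕ => Real.eulerMascheroniConstant * s + ∑ k ∈ Finset.range n,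
      (-Real.log (1 - s / (k + 1)) - s / (k + 1))) atTop (𝓝 (Real.log (Real.Gamma (1 - s)))) := by
  rw [← tendsto_add_atTop_iff_nat 1]
  have h1 := Real.BohrMollerup.tendsto_log_gamma (sub_pos.2 hs)
  have h2 := (Real.tendsto_harmonic_sub_log).const_sub Real.eulerMascheroniConstant
  have h3 : Tendsto (fun n : ℕ => Real.log (n + 1) - Real.log n) atTop (𝓝 0) :=
    Real.tendsto_log_nat_add_one_sub_log
  have h4 : Tendsto (fun n : ℕ => s / ((n : ℝ) + 1)) atTop (𝓝 0) :=
    tendsto_const_nhds.div_atTop (tendsto_atTop_add_const_right _ _ tendsto_natCast_atTop_atTop)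
  have h5 := ((h1.add (h2.const_mul s)).add h3).sub h4
  simp only [sub_self, mul_zero, add_zero, sub_zero] at h5
  refine h5.congr fun n => ?_
  rw [Real.BohrMollerup.logGammaSeq]
  have e1 : Real.log (n.factorial : ℝ)
      = ∑ k ∈ Finset.range n, Real.log ((k : ℝ) + 1) := by
    rw [← Finset.prod_range_add_one_eq_factorial]
    push_cast
    rw [Real.log_prod]
    intro k _
    positivity
  have e2 : ∀ k : ℕ, Real.log (1 - s + k) = Real.log ((k : ℝ) + 1) + Real.log (1 - s / (k + 1)) := by
    intro k
    have hk : (0 : ℝ) < k + 1 := by positivity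
    have : 0 < 1 - s / ((k : ℝ) + 1) := by
      rw [sub_pos, div_lt_one hk]
      have : (0 : ℝ) ≤ k := Nat.cast_nonneg k
      linarith
    rw [← Real.log_mul hk.ne' this.ne']
    congr 1
    field_simp
    ring
  have e3 : ((harmonic n : ℚ) : ℝ) = ∑ k ∈ Finset.range n, ((k : ℝ) + 1)⁻¹ := by
    simp [harmonic]
  rw [e1, e3, Finset.sum_congr rfl fun k _ => e2 k]
  simp only [Finset.sum_add_distrib, Finset.sum_sub_distrib, Finset.sum_neg_distrib,
    Finset.sum_range_succ, div_eq_mul_inv, ← Finset.mul_sum]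
  ring

lemma abs_log_Gamma_one_sub_le {s ζ₃ : ℝ} (hs : |s| ≤ 1 / 2)
    (hζ : HasSum (fun n : ℕ => (1 : ℝ) / ((n : ℝ) + 1) ^ 3) ζ₃) :
    |Real.log (Real.Gamma (1 - s)) - (Real.eulerMascheroniConstant * s + Real.pi ^ 2 / 12 * s ^ 2
      + ζ₃ / 3 * s ^ 3 + Real.pi ^ 4 / 360 * s ^ 4)| ≤ Real.pi ^ 2 / 3 * |s| ^ 5 := by
  have shift : ∀ {m : ℕ} {c : ℝ}, m ≠ 0 → HasSum (fun n : ℕ => (1 : ℝ) / (n : ℝ) ^ m) c →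
      HasSum (fun n : ℕ => (1 : ℝ) / ((n : ℝ) + 1) ^ m) c := by
    intro m c hm h
    have := (hasSum_nat_add_iff' 1).2 h
    simpa [hm] using this
  have z2 := shift two_ne_zero hasSum_zeta_two
  have z4 := shift four_ne_zero hasSum_zeta_four
  have hpoly : HasSum (fun k : ℕ => (s / ((k : ℝ) + 1)) ^ 2 / 2 + (s / ((k : ℝ) + 1)) ^ 3 / 3
      + (s / ((k : ℝ) + 1)) ^ 4 / 4)
      (Real.pi ^ 2 / 12 * s ^ 2 + ζ₃ / 3 * s ^ 3 + Real.pi ^ 4 / 360 * s ^ 4) := by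
    convert! ((z2.mul_left (s ^ 2 / 2)).add (hζ.mul_left (s ^ 3 / 3))).add
      (z4.mul_left (s ^ 4 / 4)) using 1
    · ext k
      simp only [div_pow]
      ring
    · ring
  have hlim := ((tendsto_log_Gamma_one_sub (s := s) (by linarith [le_abs_self s])).sub_const
    (Real.eulerMascheroniConstant * s)).sub hpoly.tendsto_sum_nat
  have hle : ∀ n : ℕ, |Real.eulerMascheroniConstant * s + ∑ k ∈ Finset.range n,
      (-Real.log (1 - s / (k + 1)) - s / (k + 1)) - Real.eulerMascheroniConstant * s
      - ∑ k ∈ Finset.range n, ((s / ((k : ℝ) + 1)) ^ 2 / 2 + (s / ((k : ℝ) + 1)) ^ 3 / 3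
      + (s / ((k : ℝ) + 1)) ^ 4 / 4)| ≤ Real.pi ^ 2 / 3 * |s| ^ 5 := by
    intro n
    rw [add_sub_cancel_left, ← Finset.sum_sub_distrib]
    have hterm : ∀ k : ℕ, |-Real.log (1 - s / (k + 1)) - s / (k + 1)
        - ((s / ((k : ℝ) + 1)) ^ 2 / 2 + (s / ((k : ℝ) + 1)) ^ 3 / 3
          + (s / ((k : ℝ) + 1)) ^ 4 / 4)| ≤ 2 * |s| ^ 5 * (1 / ((k : ℝ) + 1) ^ 2) := by
      intro k
      have hk : (1 : ℝ) ≤ k + 1 := by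
        have : (0 : ℝ) ≤ k := Nat.cast_nonneg k
        linarith
      have habs : |s / ((k : ℝ) + 1)| = |s| / (k + 1) := by
        rw [abs_div, abs_of_pos (by linarith : (0 : ℝ) < k + 1)]
      refine (abs_log_one_sub_add_le ?_).trans ?_
      · rw [habs]
        exact (div_le_self (abs_nonneg s) hk).trans hs
      · rw [habs, div_pow, mul_assoc, mul_one_div]
        exact mul_le_mul_of_nonneg_left (div_le_div_of_nonneg_left (by positivity) (by positivity)
          (pow_le_pow_right₀ hk (by norm_num))) (by norm_num)
    calc
      _ ≤ ∑ k ∈ Finset.range n, 2 * |s| ^ 5 * (1 / ((k : ℝ) + 1) ^ 2) :=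
          (Finset.abs_sum_le_sum_abs _ _).trans (Finset.sum_le_sum fun k _ => hterm k)
      _ ≤ 2 * |s| ^ 5 * (Real.pi ^ 2 / 6) := by
          rw [← Finset.mul_sum]
          gcongr
          exact sum_le_hasSum _ (fun k _ => by positivity) z2
      _ = _ := by ring
  have := le_of_tendsto hlim.abs (Eventually.of_forall hle)
  refine le_trans (le_of_eq ?_) this
  congr 1
  ring

lemma log_Gamma_one_sub_isBigO {ζ₃ : ℝ}
    (hζ : HasSum (fun n : ℕ => (1 : ℝ) / ((n : ℝ) + 1) ^ 3) ζ₃) :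
    (fun s : ℝ => Real.log (Real.Gamma (1 - s)) - (Real.eulerMascheroniConstant * s
      + Real.pi ^ 2 / 12 * s ^ 2 + ζ₃ / 3 * s ^ 3 + Real.pi ^ 4 / 360 * s ^ 4))
      =O[𝓝 0] fun s => s ^ 5 := by
  refine Asymptotics.IsBigO.of_bound (Real.pi ^ 2 / 3) ?_
  filter_upwards [Metric.closedBall_mem_nhds (0 : ℝ) (by norm_num : (0 : ℝ) < 1 / 2)] with s hs
  rw [norm_pow]
  exact abs_log_Gamma_one_sub_le (by simpa using hs) hζ

lemma coeff_eq_zero_of_sum_isBigO (n : ℕ) (c : ℕ → ℝ)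
    (h : (fun s : ℝ => ∑ k ∈ Finset.range n, c k * s ^ k) =O[𝓝[>] 0] fun s => s ^ n) :
    ∀ k < n, c k = 0 := by
  induction n generalizing c with
  | zero => simp
  | succ n ih =>
    have h0 : c 0 = 0 := by
      have hcont : Tendsto (fun s : ℝ => ∑ k ∈ Finset.range (n + 1), c k * s ^ k) (𝓝[>] 0)
          (𝓝 (c 0)) := by
        have : Continuous fun s : ℝ => ∑ k ∈ Finset.range (n + 1), c k * s ^ k := by fun_prop
        convert! (this.tendsto 0).mono_left nhdsWithin_le_nhds
        simp [Finset.sum_range_succ']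
      have hz : Tendsto (fun s : ℝ => s ^ (n + 1)) (𝓝[>] 0) (𝓝 0) := by
        convert! ((continuous_pow (n + 1)).tendsto (0 : ℝ)).mono_left nhdsWithin_le_nhds
        simp
      exact tendsto_nhds_unique hcont (h.trans_tendsto hz)
    have h' : (fun s : ℝ => ∑ k ∈ Finset.range n, c (k + 1) * s ^ k) =O[𝓝[>] 0]
        fun s => s ^ n := by
      have := (Asymptotics.isBigO_refl (fun s : ℝ => s⁻¹) (𝓝[>] 0)).mul h
      refine this.congr' ?_ ?_
      · filter_upwards [self_mem_nhdsWithin] with s hs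
        have hs : s ≠ 0 := (show 0 < s from hs).ne'
        rw [Finset.sum_range_succ', h0, zero_mul, add_zero, Finset.mul_sum]
        refine Finset.sum_congr rfl fun k _ => ?_
        field_simp
        ring
      · filter_upwards [self_mem_nhdsWithin] with s hs
        have hs : s ≠ 0 := (show 0 < s from hs).ne'
        field_simp
        ring
    intro k hk
    cases k with
    | zero => exact h0
    | succ k => exact ih (fun k => c (k + 1)) h' k (by omega)

lemma exp_quartic_isBigO (a b c : ℝ) :
    (fun s : ℝ => Real.exp (a * s ^ 2 + b * s ^ 3 + c * s ^ 4)
      - (1 + a * s ^ 2 + b * s ^ 3 + (c + a ^ 2 / 2) * s ^ 4)) =O[𝓝 0] fun s => s ^ 5 := by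
  have h1 : (fun s : ℝ => a * s ^ 2 + b * s ^ 3 + c * s ^ 4) =O[𝓝 0] fun s => s ^ 2 := by
    have e : (fun s : ℝ => a * s ^ 2 + b * s ^ 3 + c * s ^ 4)
        = fun s => (a + b * s + c * s ^ 2) * s ^ 2 := by ext s; ring
    rw [e]
    have hb : (fun s : ℝ => a + b * s + c * s ^ 2) =O[𝓝 0] fun _ => (1 : ℝ) :=
      ((by fun_prop : Continuous fun s : ℝ => a + b * s + c * s ^ 2).tendsto 0).isBigO_one ℝ
    simpa using hb.mul (Asymptotics.isBigO_refl (fun s : ℝ => s ^ 2) (𝓝 0))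
  have h2 : Tendsto (fun s : ℝ => a * s ^ 2 + b * s ^ 3 + c * s ^ 4) (𝓝 0) (𝓝 0) := by
    convert! (by fun_prop : Continuous fun s : ℝ => a * s ^ 2 + b * s ^ 3 + c * s ^ 4).tendsto 0
    simp
  have h3 := ((Real.exp_sub_sum_range_isBigO_pow 3).comp_tendsto h2).trans (h1.pow 3)
  have h4 : (fun s : ℝ => (s ^ 2) ^ 3) =O[𝓝 0] fun s : ℝ => s ^ 5 := by
    simp_rw [← pow_mul]
    exact (Asymptotics.isLittleO_pow_pow (by norm_num)).isBigO
  have h5 : (fun s : ℝ => (a * b + (b ^ 2 / 2 + a * c) * s + b * c * s ^ 2 + c ^ 2 / 2 * s ^ 3) * s ^ 5)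
      =O[𝓝 0] fun s : ℝ => s ^ 5 := by
    have hb : (fun s : ℝ => a * b + (b ^ 2 / 2 + a * c) * s + b * c * s ^ 2 + c ^ 2 / 2 * s ^ 3)
        =O[𝓝 0] fun _ => (1 : ℝ) :=
      ((by fun_prop : Continuous fun s : ℝ =>
        a * b + (b ^ 2 / 2 + a * c) * s + b * c * s ^ 2 + c ^ 2 / 2 * s ^ 3).tendsto 0).isBigO_one ℝ
    simpa using hb.mul (Asymptotics.isBigO_refl (fun s : ℝ => s ^ 5) (𝓝 0))
  refine ((h3.trans h4).add h5).congr_left fun s => ?_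
  simp only [Function.comp_apply, Finset.sum_range_succ, Finset.sum_range_zero]
  norm_num
  ring

section
variable {Ω : Type*} [MeasurableSpace Ω] {P : Measure Ω} [IsProbabilityMeasure P] {X : Ω → ℝ}

/-- The first four moments from an expansion of the cumulant generating function. -/
lemma moments_of_cgf_isBigO {a b c : ℝ} (hX : 0 ∈ interior (integrableExpSet X P))
    (h : (fun s => cgf X P s - (a * s ^ 2 + b * s ^ 3 + c * s ^ 4)) =O[𝓝[>] 0] fun s => s ^ 5) :
    ∫ ω, X ω ∂P = 0 ∧ ∫ ω, X ω ^ 2 ∂P = 2 * a ∧ ∫ ω, X ω ^ 3 ∂P = 6 * b ∧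
      ∫ ω, X ω ^ 4 ∂P = 24 * c + 12 * a ^ 2 := by
  have hpos : ∀ᶠ s in 𝓝[>] (0 : ℝ), 0 < mgf X P s := by
    filter_upwards [nhdsWithin_le_nhds (isOpen_interior.mem_nhds hX)] with s hs
    exact mgf_pos (integrable_of_mem_integrableExpSet (interior_subset hs))
  have h1 : (fun s => mgf X P s - Real.exp (a * s ^ 2 + b * s ^ 3 + c * s ^ 4))
      =O[𝓝[>] 0] fun s => s ^ 5 := by
    have hz : Tendsto (fun s : ℝ => s ^ 5) (𝓝[>] 0) (𝓝 0) := by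
      convert! ((continuous_pow 5).tendsto (0 : ℝ)).mono_left nhdsWithin_le_nhds
      simp
    have h2 := ((Real.exp_sub_sum_range_isBigO_pow 1).comp_tendsto (h.trans_tendsto hz)).trans
      (h.pow 1)
    have hb : (fun s : ℝ => Real.exp (a * s ^ 2 + b * s ^ 3 + c * s ^ 4)) =O[𝓝[>] 0]
        fun _ => (1 : ℝ) :=
      (((by fun_prop : Continuous fun s : ℝ => Real.exp (a * s ^ 2 + b * s ^ 3 + c * s ^ 4)).tendsto
        0).mono_left nhdsWithin_le_nhds).isBigO_one ℝ
    refine (hb.mul h2).congr' ?_ ?_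
    · filter_upwards [hpos] with s hs
      simp only [Function.comp_apply, Finset.sum_range_one, pow_zero, Nat.factorial_zero,
        Nat.cast_one, div_one]
      rw [mul_sub, mul_one, ← Real.exp_add, add_sub_cancel, cgf, Real.exp_log hs]
    · exact Eventually.of_forall fun s => by simp
  have h2 := (h1.add ((exp_quartic_isBigO a b c).mono nhdsWithin_le_nhds))
  have h3 := (hasFPowerSeriesAt_mgf hX).isBigO_sub_partialSum_pow 5
  simp only [zero_add, zero_mul, Real.exp_zero, mul_one] at h3
  have h4 := (h2.sub ((Asymptotics.isBigO_norm_right.1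
    (h3.congr_right fun s => by rw [norm_pow])).mono nhdsWithin_le_nhds))
  have h5 := coeff_eq_zero_of_sum_isBigO 5 (fun k => (∫ ω, X ω ^ k ∂P) / k.factorial
    - if k = 0 then 1 else if k = 2 then a else if k = 3 then b else
      if k = 4 then c + a ^ 2 / 2 else 0) (h4.congr_left fun s => by
      simp only [FormalMultilinearSeries.partialSum, FormalMultilinearSeries.ofScalars_apply_eq,
        Finset.sum_range_succ, Finset.sum_range_zero, smul_eq_mul]
      norm_num
      ring)
  have e1 := h5 1 (by norm_num)
  have e2 := h5 2 (by norm_num)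
  have e3 := h5 3 (by norm_num)
  have e4 := h5 4 (by norm_num)
  norm_num [Nat.factorial] at e1 e2 e3 e4
  refine ⟨e1, ?_, ?_, ?_⟩ <;> linarith
end

section
variable {Ω : Type*} [MeasurableSpace Ω] {P : Measure Ω} [IsProbabilityMeasure P] {T : Ω → ℝ}
  {α θ : ℝ}

lemma IsMittagLefflerTime.cgf_neg_log (h : IsMittagLefflerTime P α θ T) (hα : 0 < α)
    (hθ : 0 < θ) (hT : Measurable T) {s : ℝ} (hs : 0 < s) (hsα : s < α) :
    Integrable (fun ω => Real.exp (s * -Real.log (T ω))) P ∧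
    cgf (fun ω => -Real.log (T ω)) P s = Real.log θ / α * s + Real.log (Real.Gamma (1 + s / α))
      + Real.log (Real.Gamma (1 - s / α)) - Real.log (Real.Gamma (1 + s)) := by
  have hΓ1 : 0 < Real.Gamma (1 - s / α) :=
    Real.Gamma_pos_of_pos (sub_pos.2 ((div_lt_one hα).2 hsα))
  have hΓ2 : 0 < Real.Gamma (1 + s / α) := Real.Gamma_pos_of_pos (by positivity)
  have hΓ3 : 0 < Real.Gamma (1 + s) := Real.Gamma_pos_of_pos (by positivity)
  have hθα : 0 < θ ^ (s / α) := Real.rpow_pos_of_pos hθ _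
  have hl : ∫⁻ ω, ENNReal.ofReal (Real.exp (s * -Real.log (T ω))) ∂P
      = ENNReal.ofReal (θ ^ (s / α) *
      Real.Gamma (1 + s / α) * Real.Gamma (1 - s / α) / Real.Gamma (1 + s)) := by
    rw [← h.lintegral_rpow_neg hα hθ hT hs hsα]
    refine lintegral_congr_ae ?_
    filter_upwards [h.ae_pos hα hθ hT] with ω hω
    rw [Real.rpow_def_of_pos hω]
    congr 2
    ring
  have hi : Integrable (fun ω => Real.exp (s * -Real.log (T ω))) P :=
    ⟨(by fun_prop : Measurable _).aestronglyMeasurable, by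
      rw [hasFiniteIntegral_iff_ofReal (ae_of_all _ fun ω => (Real.exp_pos _).le), hl]
      exact ENNReal.ofReal_lt_top⟩
  refine ⟨hi, ?_⟩
  rw [cgf, mgf, integral_eq_lintegral_of_nonneg_ae (ae_of_all _ fun ω => (Real.exp_pos _).le) hi.1,
    hl, ENNReal.toReal_ofReal (by positivity), Real.log_div (by positivity) hΓ3.ne',
    Real.log_mul (by positivity) hΓ1.ne', Real.log_mul hθα.ne' hΓ2.ne', Real.log_rpow hθ]
  ring

lemma IsMittagLefflerTime.zero_mem_interior_integrableExpSet (h : IsMittagLefflerTime P α θ T)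
    (hα : 0 < α) (hθ : 0 < θ) (hT : Measurable T) (m : ℝ) :
    0 ∈ interior (integrableExpSet (fun ω => -Real.log (T ω) - m) P) := by
  have key : ∀ s : ℝ, Integrable (fun ω => Real.exp (s * -Real.log (T ω))) P →
      s ∈ integrableExpSet (fun ω => -Real.log (T ω) - m) P := by
    intro s hs
    refine (hs.mul_const (Real.exp (-(s * m)))).congr (ae_of_all _ fun ω => ?_)
    simp only
    rw [← Real.exp_add]
    congr 1
    ring
  have hr := key (α / 2) (h.cgf_neg_log hα hθ hT (by positivity) (by linarith)).1
  have hl := key (-(α / 2)) (by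
    refine ⟨(by fun_prop : Measurable _).aestronglyMeasurable, ?_⟩
    rw [hasFiniteIntegral_iff_ofReal (ae_of_all _ fun ω => (Real.exp_pos _).le)]
    refine lt_of_eq_of_lt (lintegral_congr_ae ?_)
      (h.lintegral_rpow_lt_top hα hθ hT (half_pos hα) (by linarith))
    filter_upwards [h.ae_pos hα hθ hT] with ω hω
    rw [Real.rpow_def_of_pos hω]
    congr 2
    ring)
  refine mem_interior.2 ⟨Set.Ioo (-(α / 2)) (α / 2), ?_, isOpen_Ioo, by simp [hα]⟩
  exact Set.Ioo_subset_Icc_self.trans (convex_integrableExpSet.ordConnected.out hl hr)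

/-- The first four central moments of `-log T` for a Mittag-Leffler variable `T`. -/
lemma IsMittagLefflerTime.moments_log (h : IsMittagLefflerTime P α θ T)
    (hα : 0 < α) (hθ : 0 < θ) (hT : Measurable T) {ζ₃ : ℝ}
    (hζ : HasSum (fun n : ℕ => (1 : ℝ) / ((n : ℝ) + 1) ^ 3) ζ₃) (V : Ω → ℝ)
    (hV : V = fun ω => -Real.log (T ω) - (Real.log θ / α + Real.eulerMascheroniConstant)) :
    ∫ ω, V ω ∂P = 0 ∧
    ∫ ω, V ω ^ 2 ∂P = Real.pi ^ 2 / (3 * α ^ 2) - Real.pi ^ 2 / 6 ∧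
    ∫ ω, V ω ^ 3 ∂P = 2 * ζ₃ ∧
    ∫ ω, V ω ^ 4 ∂P = 2 * Real.pi ^ 4 / (15 * α ^ 4) - Real.pi ^ 4 / 15
      + 3 * (Real.pi ^ 2 / (3 * α ^ 2) - Real.pi ^ 2 / 6) ^ 2 := by
  have hint := h.zero_mem_interior_integrableExpSet hα hθ hT
    (Real.log θ / α + Real.eulerMascheroniConstant)
  rw [← hV] at hint
  set a := Real.pi ^ 2 / (6 * α ^ 2) - Real.pi ^ 2 / 12 with ha
  set b := ζ₃ / 3 with hb
  set c := Real.pi ^ 4 / (180 * α ^ 4) - Real.pi ^ 4 / 360 with hc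
  have hG := log_Gamma_one_sub_isBigO hζ
  have scale : ∀ r : ℝ, (fun s : ℝ => Real.log (Real.Gamma (1 - r * s))
      - (Real.eulerMascheroniConstant * (r * s)
      + Real.pi ^ 2 / 12 * (r * s) ^ 2 + ζ₃ / 3 * (r * s) ^ 3 + Real.pi ^ 4 / 360 * (r * s) ^ 4))
      =O[𝓝[>] 0] fun s => s ^ 5 := by
    intro r
    have ht : Tendsto (fun s : ℝ => r * s) (𝓝[>] 0) (𝓝 0) := by
      convert! ((continuous_const_mul r).tendsto (0 : ℝ)).mono_left nhdsWithin_le_nhds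
      simp
    refine (hG.comp_tendsto ht).trans ?_
    simp only [Function.comp_def, mul_pow]
    exact Asymptotics.isBigO_const_mul_self _ _ _
  have hexp : (fun s => cgf V P s - (a * s ^ 2 + b * s ^ 3 + c * s ^ 4))
      =O[𝓝[>] 0] fun s => s ^ 5 := by
    refine (((scale (-α⁻¹)).add (scale α⁻¹)).sub (scale (-1))).congr' ?_ EventuallyEq.rfl
    filter_upwards [Ioo_mem_nhdsGT hα] with s hs
    obtain ⟨hi, hcgf⟩ := h.cgf_neg_log hα hθ hT hs.1 hs.2
    have h1 : cgf V P s = cgf (fun ω => -Real.log (T ω)) P s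
        - (Real.log θ / α + Real.eulerMascheroniConstant) * s := by
      have e : mgf V P s = mgf (fun ω => -Real.log (T ω)) P s
          * Real.exp (-((Real.log θ / α + Real.eulerMascheroniConstant) * s)) := by
        rw [mgf, mgf, hV, ← integral_mul_const]
        refine integral_congr_ae (ae_of_all _ fun ω => ?_)
        simp only
        rw [← Real.exp_add]
        ring_nf
      rw [cgf, e, Real.log_mul (mgf_pos hi).ne' (Real.exp_pos _).ne', Real.log_exp, cgf]
      ring
    rw [h1, hcgf, show 1 - -α⁻¹ * s = 1 + s / α by ring, show 1 - α⁻¹ * s = 1 - s / α by ring,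
      show 1 - -1 * s = 1 + s by ring, ha, hb, hc]
    field_simp
    ring
  obtain ⟨m1, m2, m3, m4⟩ := moments_of_cgf_isBigO hint hexp
  refine ⟨m1, m2.trans ?_, m3.trans ?_, m4.trans ?_⟩
  · rw [ha]; field_simp; ring
  · rw [hb]; ring
  · rw [ha, hc]; field_simp; ring
end

section
variable {Ω : Type*} [MeasurableSpace Ω] {P : Measure Ω} [IsProbabilityMeasure P]

lemma tendstoInDistribution_add_gaussianReal {A B : ℕ → Ω → ℝ} {v w : ℝ≥0}
    (hA : TendstoInDistribution A atTop (id : ℝ → ℝ) (fun _ => P) (gaussianReal 0 v))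
    (hB : TendstoInDistribution B atTop (id : ℝ → ℝ) (fun _ => P) (gaussianReal 0 w))
    (hAB : ∀ n, IndepFun (A n) (B n) P) :
    TendstoInDistribution (fun n ω => A n ω + B n ω) atTop (id : ℝ → ℝ) (fun _ => P)
      (gaussianReal 0 (v + w)) where
  forall_aemeasurable n := (hA.forall_aemeasurable n).add (hB.forall_aemeasurable n)
  tendsto := by
    refine ProbabilityMeasure.tendsto_iff_tendsto_charFun.2 fun t => ?_
    have h1 := ProbabilityMeasure.tendsto_iff_tendsto_charFun.1 hA.tendsto t
    have h2 := ProbabilityMeasure.tendsto_iff_tendsto_charFun.1 hB.tendsto t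
    simp only [ProbabilityMeasure.coe_mk, Measure.map_id] at h1 h2 ⊢
    have h3 := h1.mul h2
    have e : charFun (gaussianReal 0 v) t * charFun (gaussianReal 0 w) t
        = charFun (gaussianReal 0 (v + w)) t := by
      rw [charFun_gaussianReal, charFun_gaussianReal, charFun_gaussianReal, ← Complex.exp_add]
      push_cast
      ring_nf
    rw [e] at h3
    refine h3.congr fun n => ?_
    rw [(hAB n).charFun_map_fun_add_eq_mul (hA.forall_aemeasurable n) (hB.forall_aemeasurable n)]
    rfl

/-- The **delta method**, for a sequence that satisfies a Chebyshev bound. -/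
lemma tendstoInDistribution_delta_method {E : Type*} [NormedAddCommGroup E] [NormedSpace ℝ E]
    {Ω' : Type*} [MeasurableSpace Ω'] {P' : Measure Ω'} [IsProbabilityMeasure P'] {Z : Ω' → ℝ}
    {W : ℕ → Ω → E} {w : E} {g : E → ℝ} {g' : E →L[ℝ] ℝ} {C : ℝ} (hg : HasFDerivAt g g' w)
    (hW : ∀ (n : ℕ) (K : ℝ), 0 < K → P.real {ω | K ≤ √n * ‖W n ω - w‖} ≤ C / K ^ 2)
    (hlin : TendstoInDistribution (fun (n : ℕ) ω => √n * g' (W n ω - w)) atTop Z (fun _ => P) P')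
    (hmeas : ∀ n, AEMeasurable (fun ω => g (W n ω)) P) :
    TendstoInDistribution (fun (n : ℕ) ω => √n * (g (W n ω) - g w)) atTop Z (fun _ => P) P' := by
  refine tendstoInDistribution_of_tendstoInMeasure_sub _ Z hlin ?_
    fun n => ((hmeas n).sub_const _).const_mul _
  rw [tendstoInMeasure_iff_measureReal_norm]
  intro ε hε
  simp only [Pi.sub_apply, Pi.zero_apply, sub_zero]
  have hC : 0 ≤ C := by
    have := measureReal_nonneg.trans (hW 0 1 one_pos)
    simpa using this
  rw [Metric.tendsto_nhds]
  intro δ hδ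
  set η := ε * √(δ / (2 * (C + 1))) with hη
  have hη0 : 0 < η := by positivity
  have hηC : C / (ε / η) ^ 2 < δ / 2 := by
    rw [hη, div_mul_cancel_left₀ hε.ne', inv_pow, Real.sq_sqrt (by positivity), div_inv_eq_mul]
    rw [← mul_div_assoc, div_lt_div_iff₀ (by positivity) two_pos]
    nlinarith
  obtain ⟨r, hr, hball⟩ := Metric.eventually_nhds_iff_ball.1 (hg.isLittleO.def hη0)
  have hlim : Tendsto (fun n : ℕ => C / r ^ 2 / (n : ℝ)) atTop (𝓝 0) :=
    tendsto_const_nhds.div_atTop tendsto_natCast_atTop_atTop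
  filter_upwards [hlim.eventually_lt_const (half_pos hδ), eventually_gt_atTop 0] with n hn hn0
  have hn0' : (0 : ℝ) < n := by exact_mod_cast hn0
  have hsq : 0 < √(n : ℝ) := Real.sqrt_pos.2 hn0'
  rw [Real.dist_eq, sub_zero, abs_of_nonneg measureReal_nonneg]
  calc
    _ ≤ P.real ({ω | √n * r ≤ √n * ‖W n ω - w‖} ∪ {ω | ε / η ≤ √n * ‖W n ω - w‖}) := by
        refine measureReal_mono fun ω hω => ?_
        simp only [Set.mem_ofPred_eq, Set.mem_union] at hω ⊢
        by_contra! hcon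
        have h1 : ‖W n ω - w‖ < r := lt_of_mul_lt_mul_left hcon.1 hsq.le
        have h2 := hball (W n ω) (by simpa [dist_eq_norm] using h1)
        rw [← mul_sub, norm_mul, Real.norm_of_nonneg hsq.le] at hω
        have h3 : √(n : ℝ) * ‖g (W n ω) - g w - g' (W n ω - w)‖
            ≤ η * (√n * ‖W n ω - w‖) := by
          calc
            _ ≤ √(n : ℝ) * (η * ‖W n ω - w‖) := by gcongr
            _ = _ := by ring
        have h4 := (lt_div_iff₀' hη0).1 hcon.2
        linarith
    _ ≤ P.real {ω | √n * r ≤ √n * ‖W n ω - w‖} + P.real {ω | ε / η ≤ √n * ‖W n ω - w‖} :=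
        measureReal_union_le _ _
    _ ≤ C / (√n * r) ^ 2 + C / (ε / η) ^ 2 :=
        add_le_add (hW n _ (by positivity)) (hW n _ (by positivity))
    _ < δ / 2 + δ / 2 := by
        refine add_lt_add ?_ hηC
        rw [mul_pow, Real.sq_sqrt hn0'.le]
        refine lt_of_eq_of_lt ?_ hn
        rw [div_div, mul_comm]
    _ = δ := add_halves δ

lemma measureReal_le_sqrt_mul_abs_mean_sub_le {Y : ℕ → Ω → ℝ} (hY : MemLp (Y 0) 2 P)
    (hindep : iIndepFun Y P) (hident : ∀ i, IdentDistrib (Y i) (Y 0) P P) (n : ℕ) {K : ℝ}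
    (hK : 0 < K) :
    P.real {ω | K ≤ √n * |(∑ k ∈ Finset.range n, Y k ω) / n - ∫ ω, Y 0 ω ∂P|}
      ≤ Var[Y 0; P] / K ^ 2 := by
  rcases Nat.eq_zero_or_pos n with rfl | hn
  · simp only [CharP.cast_eq_zero, Real.sqrt_zero, zero_mul, not_le.2 hK, Set.ofPred_false,
      measureReal_empty]
    have := variance_nonneg (Y 0) P
    positivity
  have hn' : (0 : ℝ) < n := by exact_mod_cast hn
  have hsq : 0 < √(n : ℝ) := Real.sqrt_pos.2 hn'
  have hmem : ∀ k, MemLp (Y k) 2 P := fun k => (hident k).memLp_iff.2 hY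
  have hsum : MemLp (fun ω => (∑ k ∈ Finset.range n, Y k ω) / n) 2 P := by
    have := (memLp_finsetSum (Finset.range n) fun k _ => hmem k).const_mul ((n : ℝ)⁻¹)
    refine this.ae_eq (ae_of_all _ fun ω => ?_)
    simp only
    ring
  have hmean : ∫ ω, (∑ k ∈ Finset.range n, Y k ω) / n ∂P = ∫ ω, Y 0 ω ∂P := by
    rw [integral_div, integral_finsetSum _ fun k _ => (hmem k).integrable one_le_two]
    simp only [fun k => (hident k).integral_eq, Finset.sum_const, Finset.card_range, nsmul_eq_mul]
    field_simp
  have hvar : Var[fun ω => (∑ k ∈ Finset.range n, Y k ω) / n; P] = Var[Y 0; P] / n := by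
    have h1 := IndepFun.variance_sum (X := Y) (s := Finset.range n) (fun k _ => hmem k)
      (fun i _ j _ hij => hindep.indepFun hij)
    simp only [fun k => (hident k).variance_eq, Finset.sum_const, Finset.card_range,
      nsmul_eq_mul] at h1
    have h2 : (fun ω => (∑ k ∈ Finset.range n, Y k ω) / n)
        = fun ω => (n : ℝ)⁻¹ * (∑ k ∈ Finset.range n, Y k) ω := by
      ext ω
      rw [Finset.sum_apply]
      ring
    rw [h2, variance_const_mul, h1]
    field_simp
  have h1 := meas_ge_le_variance_div_sq hsum (c := K / √n) (by positivity)
  rw [hmean, hvar] at h1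
  have h2 : {ω | K ≤ √n * |(∑ k ∈ Finset.range n, Y k ω) / n - ∫ ω, Y 0 ω ∂P|}
      = {ω | K / √n ≤ |(∑ k ∈ Finset.range n, Y k ω) / n - ∫ ω, Y 0 ω ∂P|} := by
    ext ω
    simp only [Set.mem_ofPred_eq]
    rw [div_le_iff₀' hsq]
  rw [h2]
  refine (ENNReal.toReal_mono ENNReal.ofReal_ne_top h1).trans (le_of_eq ?_)
  have := variance_nonneg (Y 0) P
  rw [ENNReal.toReal_ofReal (by positivity), div_pow, Real.sq_sqrt hn'.le]
  field_simp

lemma tendstoInDistribution_sqrt_mul_mean_sub {Y : ℕ → Ω → ℝ} (hY : MemLp (Y 0) 2 P)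
    (hindep : iIndepFun Y P) (hident : ∀ i, IdentDistrib (Y i) (Y 0) P P) :
    TendstoInDistribution
      (fun (n : ℕ) ω => √n * ((∑ k ∈ Finset.range n, Y k ω) / n - ∫ ω, Y 0 ω ∂P)) atTop
      (id : ℝ → ℝ) (fun _ => P) (gaussianReal 0 Var[Y 0; P].toNNReal) := by
  have h := tendstoInDistribution_inv_sqrt_mul_sum_sub (Y := (id : ℝ → ℝ))
    (P' := gaussianReal 0 Var[Y 0; P].toNNReal) HasLaw.id hY hindep hident
  refine h.congr (fun n => ae_of_all _ fun ω => ?_) EventuallyEq.rfl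
  rcases Nat.eq_zero_or_pos n with rfl | hn
  · simp
  have hn' : (0 : ℝ) < n := by exact_mod_cast hn
  have hsq : 0 < √(n : ℝ) := Real.sqrt_pos.2 hn'
  field_simp
  rw [Real.sq_sqrt hn'.le]

end

lemma hasSum_one_div_nat_add_one_pow_three :
    HasSum (fun n : ℕ => (1 : ℝ) / ((n : ℝ) + 1) ^ 3) (riemannZeta 3).re := by
  have hs : Summable fun n : ℕ => (1 : ℝ) / (n : ℝ) ^ 3 :=
    Real.summable_one_div_nat_pow.2 (by norm_num)
  have h1 : riemannZeta 3 = ((∑' n : ℕ, (1 : ℝ) / (n : ℝ) ^ 3 : ℝ) : ℂ) := by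
    have := zeta_nat_eq_tsum_of_gt_one (k := 3) (by norm_num)
    push_cast at this ⊢
    exact this
  rw [h1, Complex.ofReal_re]
  have := (hasSum_nat_add_iff' 1).2 hs.hasSum
  simpa using this

/-- The estimator of the birth rate as a function of the birth proportion and of the first two
sample moments of the centred variables `-log S`. -/
noncomputable def birthRateFun (c : ℝ) (x : ℝ × ℝ × ℝ) : ℝ :=
  x.1 * Real.exp (Real.pi / √(3 * (x.2.2 - x.2.1 ^ 2 + Real.pi ^ 2 / 6)) * (x.2.1 + c))

lemma measurable_birthRateFun (c : ℝ) : Measurable (birthRateFun c) := by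
  unfold birthRateFun
  fun_prop

lemma sqrt_three_mul_log_variance {α : ℝ} (hα : 0 < α) :
    √(3 * (Real.pi ^ 2 / (3 * α ^ 2) - Real.pi ^ 2 / 6 + Real.pi ^ 2 / 6)) = Real.pi / α := by
  rw [show 3 * (Real.pi ^ 2 / (3 * α ^ 2) - Real.pi ^ 2 / 6 + Real.pi ^ 2 / 6)
    = (Real.pi / α) ^ 2 by field_simp; ring]
  exact Real.sqrt_sq (by positivity)

lemma hasDerivAt_pi_div_sqrt {α : ℝ} (hα : 0 < α) :
    HasDerivAt (fun u : ℝ => Real.pi / √(3 * (u + Real.pi ^ 2 / 6)))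
      (-(3 * α ^ 3 / (2 * Real.pi ^ 2))) (Real.pi ^ 2 / (3 * α ^ 2) - Real.pi ^ 2 / 6) := by
  have hπ := Real.pi_pos
  have h0 := sqrt_three_mul_log_variance hα
  have h1 : HasDerivAt (fun u : ℝ => 3 * (u + Real.pi ^ 2 / 6)) 3
      (Real.pi ^ 2 / (3 * α ^ 2) - Real.pi ^ 2 / 6) := by
    simpa using ((hasDerivAt_id _).add_const (Real.pi ^ 2 / 6)).const_mul (3 : ℝ)
  have h2 := h1.sqrt (by
    intro h
    rw [h, Real.sqrt_zero] at h0
    exact (by positivity : Real.pi / α ≠ 0) h0.symm)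
  have h3 := (h2.fun_inv (by rw [h0]; positivity)).const_mul Real.pi
  rw [h0] at h3
  convert! h3 using 1
  field_simp

lemma birthRateFun_apply {α θ : ℝ} (p : ℝ) (hα : 0 < α) (hθ : 0 < θ) :
    birthRateFun (Real.log θ / α) (p, 0, Real.pi ^ 2 / (3 * α ^ 2) - Real.pi ^ 2 / 6)
      = p * θ := by
  have hπ := Real.pi_pos
  simp only [birthRateFun, ne_eq, OfNat.ofNat_ne_zero, not_false_eq_true, zero_pow, sub_zero,
    zero_add, sqrt_three_mul_log_variance hα]
  rw [show Real.pi / (Real.pi / α) * (Real.log θ / α) = Real.log θ by field_simp,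
    Real.exp_log hθ]

lemma hasFDerivAt_birthRateFun {α θ : ℝ} (p : ℝ) (hα : 0 < α) (hθ : 0 < θ) :
    ∃ g' : ℝ × ℝ × ℝ →L[ℝ] ℝ, HasFDerivAt (birthRateFun (Real.log θ / α)) g'
        (p, 0, Real.pi ^ 2 / (3 * α ^ 2) - Real.pi ^ 2 / 6) ∧
      ∀ b v q : ℝ, g' (b, v, q) = θ * b + (p * θ * α * v
        + -(p * θ * (3 * α ^ 2 * Real.log θ / (2 * Real.pi ^ 2))) * q) := by
  have hπ := Real.pi_pos
  set κ := Real.pi ^ 2 / (3 * α ^ 2) - Real.pi ^ 2 / 6 with hκ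
  have hb : HasFDerivAt (fun x : ℝ × ℝ × ℝ => x.1) (ContinuousLinearMap.fst ℝ ℝ (ℝ × ℝ))
    (p, 0, κ) := (ContinuousLinearMap.fst ℝ ℝ (ℝ × ℝ)).hasFDerivAt
  have hv : HasFDerivAt (fun x : ℝ × ℝ × ℝ => x.2.1)
    ((ContinuousLinearMap.fst ℝ ℝ ℝ).comp (ContinuousLinearMap.snd ℝ ℝ (ℝ × ℝ))) (p, 0, κ) :=
    ((ContinuousLinearMap.fst ℝ ℝ ℝ).comp (ContinuousLinearMap.snd ℝ ℝ (ℝ × ℝ))).hasFDerivAt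
  have hq : HasFDerivAt (fun x : ℝ × ℝ × ℝ => x.2.2)
    ((ContinuousLinearMap.snd ℝ ℝ ℝ).comp (ContinuousLinearMap.snd ℝ ℝ (ℝ × ℝ))) (p, 0, κ) :=
    ((ContinuousLinearMap.snd ℝ ℝ ℝ).comp (ContinuousLinearMap.snd ℝ ℝ (ℝ × ℝ))).hasFDerivAt
  have hu := hq.fun_sub (hv.pow 2)
  have hψ := (hκ ▸ hasDerivAt_pi_div_sqrt hα : HasDerivAt _ _ κ)
  have h1 := HasDerivAt.comp_hasFDerivAt_of_eq (p, 0, κ) hψ hu (by simp)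
  have h2 := hb.fun_mul ((h1.fun_mul (hv.add_const (Real.log θ / α))).exp)
  refine ⟨_, h2, fun b v q => ?_⟩
  have e : α * (Real.log θ / α) = Real.log θ := by field_simp
  have e' : Real.pi / √(3 * (κ + Real.pi ^ 2 / 6)) = α := by
    rw [hκ, sqrt_three_mul_log_variance hα]
    field_simp
  simp only [Function.comp_apply, zero_pow two_ne_zero, sub_zero, zero_add, e', e,
    Real.exp_log hθ]
  simp
  field_simp
  ring

section
variable {Ω : Type*} [MeasurableSpace Ω] {P : Measure Ω} [IsProbabilityMeasure P]

lemma IsMittagLefflerTime.identDistrib {α θ : ℝ} {S T : Ω → ℝ} (hS : IsMittagLefflerTime P α θ S)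
    (hT : IsMittagLefflerTime P α θ T) (hα : 0 < α) (hSm : Measurable S) (hTm : Measurable T) :
    IdentDistrib S T P P := by
  refine ⟨hSm.aemeasurable, hTm.aemeasurable, ?_⟩
  have := Measure.isProbabilityMeasure_map (μ := P) hSm.aemeasurable
  have := Measure.isProbabilityMeasure_map (μ := P) hTm.aemeasurable
  refine Measure.ext_of_Ici _ _ fun t => ?_
  rw [Measure.map_apply hSm measurableSet_Ici, Measure.map_apply hTm measurableSet_Ici]
  change P {ω | t ≤ S ω} = P {ω | t ≤ T ω}
  rcases le_or_gt 0 t with ht | ht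
  · rw [← measureReal_eq_measureReal_iff, hS t ht, hT t ht]
  · have aux : ∀ {R : Ω → ℝ}, 0 ≤ᵐ[P] R → P {ω | t ≤ R ω} = 1 := by
      intro R hR
      rw [← measure_univ (μ := P)]
      refine measure_congr (eventuallyEq_univ.2 ?_)
      filter_upwards [hR] with ω hω using ht.le.trans hω
    rw [aux (hS.ae_nonneg hα hSm), aux (hT.ae_nonneg hα hTm)]

lemma identDistrib_of_range_zero_one {X Y : Ω → ℕ} (hX : Measurable X) (hY : Measurable Y)
    (hX01 : ∀ ω, X ω = 0 ∨ X ω = 1) (hY01 : ∀ ω, Y ω = 0 ∨ Y ω = 1)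
    (h : P.real {ω | X ω = 1} = P.real {ω | Y ω = 1}) : IdentDistrib X Y P P := by
  refine ⟨hX.aemeasurable, hY.aemeasurable, Measure.ext_of_singleton fun k => ?_⟩
  rw [Measure.map_apply hX (measurableSet_singleton k),
    Measure.map_apply hY (measurableSet_singleton k)]
  change P {ω | X ω = k} = P {ω | Y ω = k}
  have h1 : P {ω | X ω = 1} = P {ω | Y ω = 1} := by rwa [← measureReal_eq_measureReal_iff]
  have hc : ∀ {R : Ω → ℕ}, (∀ ω, R ω = 0 ∨ R ω = 1) → {ω | R ω = 0} = {ω | R ω = 1}ᶜ := by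
    intro R hR
    ext ω
    rcases hR ω with h | h <;> simp [h]
  have hms : ∀ {R : Ω → ℕ}, Measurable R → MeasurableSet {ω | R ω = 1} := fun hR =>
    hR (measurableSet_singleton 1)
  match k with
  | 0 => rw [hc hX01, hc hY01, prob_compl_eq_one_sub (hms hX), prob_compl_eq_one_sub (hms hY), h1]
  | 1 => exact h1
  | k + 2 =>
    have he : ∀ {R : Ω → ℕ}, (∀ ω, R ω = 0 ∨ R ω = 1) → {ω | R ω = k + 2} = ∅ := by
      intro R hR
      ext ω
      rcases hR ω with h | h <;> simp [h]
    rw [he hX01, he hY01]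

/-- Mean and variance of a linear combination of a centred variable and its centred square. -/
lemma integral_and_variance_linear_add_sq {V : Ω → ℝ} {κ m₃ m₄ : ℝ} (hV : Measurable V)
    (hint : ∀ n : ℕ, Integrable (fun ω => V ω ^ n) P) (h1 : ∫ ω, V ω ∂P = 0)
    (h2 : ∫ ω, V ω ^ 2 ∂P = κ) (h3 : ∫ ω, V ω ^ 3 ∂P = m₃) (h4 : ∫ ω, V ω ^ 4 ∂P = m₄) (a b : ℝ) :
    MemLp (fun ω => a * V ω + b * V ω ^ 2) 2 P ∧
    ∫ ω, a * V ω + b * V ω ^ 2 ∂P = b * κ ∧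
    Var[fun ω => a * V ω + b * V ω ^ 2; P] = a ^ 2 * κ + 2 * a * b * m₃ + b ^ 2 * (m₄ - κ ^ 2) := by
  have i1 : Integrable V P := by simpa using hint 1
  have e : ∀ ω, (a * V ω + b * V ω ^ 2) ^ 2
      = a ^ 2 * V ω ^ 2 + 2 * a * b * V ω ^ 3 + b ^ 2 * V ω ^ 4 := fun ω => by ring
  have hm : MemLp (fun ω => a * V ω + b * V ω ^ 2) 2 P := by
    rw [memLp_two_iff_integrable_sq (by fun_prop)]
    simp_rw [e]
    exact (((hint 2).const_mul _).add ((hint 3).const_mul _)).add ((hint 4).const_mul _)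
  have hmean : ∫ ω, a * V ω + b * V ω ^ 2 ∂P = b * κ := by
    rw [integral_add (i1.const_mul a) ((hint 2).const_mul b), integral_const_mul,
      integral_const_mul, h1, h2]
    ring
  refine ⟨hm, hmean, ?_⟩
  rw [variance_eq_sub hm, hmean]
  simp only [Pi.pow_apply, e]
  have i23 : Integrable (fun ω => a ^ 2 * V ω ^ 2 + 2 * a * b * V ω ^ 3) P :=
    ((hint 2).const_mul _).add ((hint 3).const_mul _)
  rw [integral_add i23 ((hint 4).const_mul _),
    integral_add ((hint 2).const_mul _) ((hint 3).const_mul _), integral_const_mul,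
    integral_const_mul, integral_const_mul, h2, h3, h4]
  ring

end

section
variable {Ω : Type*}

lemma birth_eq_zero_or_one (X : ℕ → Ω → ℤ) (k : ℕ) (ω : Ω) : birth X k ω = 0 ∨ birth X k ω = 1 := by
  unfold birth
  split_ifs <;> simp

lemma measurable_birth [MeasurableSpace Ω] {X : ℕ → Ω → ℤ} (hX : ∀ k, Measurable (X k)) (k : ℕ) :
    Measurable (birth X k) :=
  Measurable.ite (measurableSet_eq_fun (hX (k + 1)) ((hX k).add_const 1)) measurable_const
    measurable_const

/-- `lambdaHat` in terms of the centred variables `-log S - m`. -/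
lemma lambdaHat_eq_birthRateFun (S : ℕ → Ω → ℝ) (X : ℕ → Ω → ℤ) (c : ℝ) {n : ℕ} (hn : n ≠ 0)
    (ω : Ω) (V : ℕ → Ω → ℝ)
    (hV : V = fun k ω => -Real.log (S k ω) - (c + Real.eulerMascheroniConstant)) :
    lambdaHat S X n ω = birthRateFun c ((∑ k ∈ Finset.range n, (birth X k ω : ℝ)) / n,
      (∑ k ∈ Finset.range n, V k ω) / n, (∑ k ∈ Finset.range n, V k ω ^ 2) / n) := by
  have hn' : (n : ℝ) ≠ 0 := by exact_mod_cast hn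
  set v := (∑ k ∈ Finset.range n, V k ω) / n with hv
  have hlog : ∀ k, Real.log (S k ω) = -V k ω - (c + Real.eulerMascheroniConstant) := by
    intro k
    rw [hV]
    ring
  have hmean : logMean S n ω = -v - (c + Real.eulerMascheroniConstant) := by
    simp only [logMean, hlog, Finset.sum_sub_distrib, Finset.sum_neg_distrib, Finset.sum_const,
      Finset.card_range, nsmul_eq_mul, hv]
    field_simp
  have hvar : logVar S n ω = (∑ k ∈ Finset.range n, V k ω ^ 2) / n - v ^ 2 := by
    have e : ∀ k, (Real.log (S k ω) - logMean S n ω) ^ 2 = V k ω ^ 2 - 2 * v * V k ω + v ^ 2 := by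
      intro k
      rw [hlog, hmean]
      ring
    simp only [logVar, e, Finset.sum_add_distrib, Finset.sum_sub_distrib, ← Finset.mul_sum,
      Finset.sum_const, Finset.card_range, nsmul_eq_mul]
    rw [show ∑ k ∈ Finset.range n, V k ω = n * v by rw [hv]; field_simp]
    field_simp
    ring
  simp only [lambdaHat, thetaHat, alphaHat, numBirths, birthRateFun, hmean, hvar]
  push_cast
  congr 2
  ring

end

lemma sigmaThetaSq_eq {α θ : ℝ} (hα : 0 < α) :
    sigmaThetaSq α θ = (θ * α) ^ 2 * (Real.pi ^ 2 / (3 * α ^ 2) - Real.pi ^ 2 / 6)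
      + 2 * (θ * α) * -(θ * (3 * α ^ 2 * Real.log θ / (2 * Real.pi ^ 2))) * (2 * (riemannZeta 3).re)
      + (-(θ * (3 * α ^ 2 * Real.log θ / (2 * Real.pi ^ 2)))) ^ 2
        * (2 * Real.pi ^ 4 / (15 * α ^ 4) - Real.pi ^ 4 / 15
          + 3 * (Real.pi ^ 2 / (3 * α ^ 2) - Real.pi ^ 2 / 6) ^ 2
          - (Real.pi ^ 2 / (3 * α ^ 2) - Real.pi ^ 2 / 6) ^ 2) := by
  have hπ := Real.pi_pos
  rw [sigmaThetaSq]
  field_simp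
  ring

theorem mainTheorem7 {Ω : Type*} [MeasurableSpace Ω] (P : Measure Ω) [IsProbabilityMeasure P]
    (α lam mu : ℝ) (hα : 0 < α) (hα1 : α ≤ 1) (hlam : 0 < lam) (hmu : 0 < mu) (i : ℕ)
    (N : ℝ → Ω → ℤ) (S : ℕ → Ω → ℝ) (X : ℕ → Ω → ℤ)
    (hN : IsFractionalQueue P α lam mu i N S X)
    (θ p v : ℝ) (hθ : θ = lam + mu) (hp : p = lam / θ)
    (hv : v = θ ^ 2 * (p * (1 - p)) + p ^ 2 * sigmaThetaSq α θ) :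
    0 ≤ sigmaThetaSq α θ ∧
    TendstoInDistribution (fun (n : ℕ) ω => Real.sqrt n * (lambdaHat S X n ω - lam)) atTop
      (id : ℝ → ℝ) (fun _ => P) (gaussianReal 0 v.toNNReal) := by
  have hθ0 : 0 < θ := by rw [hθ]; positivity
  have hSm := hN.measurable_time
  have hlaw : ∀ k, IsMittagLefflerTime P α θ (S k) := fun k => hθ ▸ hN.time_law k
  set V : ℕ → Ω → ℝ := fun k ω => -Real.log (S k ω)
    - (Real.log θ / α + Real.eulerMascheroniConstant) with hV
  set κ := Real.pi ^ 2 / (3 * α ^ 2) - Real.pi ^ 2 / 6 with hκ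
  have hφm : Measurable fun x : ℝ =>
    -Real.log x - (Real.log θ / α + Real.eulerMascheroniConstant) := by fun_prop
  have hVm : ∀ k, Measurable (V k) := fun k => hφm.comp (hSm k)
  have hVindep : iIndepFun V P := hN.time_indep.comp _ fun _ => hφm
  have hVident : ∀ k, IdentDistrib (V k) (V 0) P P := fun k =>
    ((hlaw k).identDistrib (hlaw 0) hα (hSm k) (hSm 0)).comp hφm
  have hVint : ∀ n : ℕ, Integrable (fun ω => V 0 ω ^ n) P := fun n =>
    integrable_pow_of_mem_interior_integrableExpSet
      ((hlaw 0).zero_mem_interior_integrableExpSet hα hθ0 (hSm 0) _) n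
  obtain ⟨m1, m2, m3, m4⟩ := (hlaw 0).moments_log hα hθ0 (hSm 0)
    hasSum_one_div_nat_add_one_pow_three (V 0) rfl
  rw [← hκ] at m2 m4
  have hlin := integral_and_variance_linear_add_sq (hVm 0) hVint m1 m2 m3 m4
  -- the births
  set B : ℕ → Ω → ℝ := fun k ω => birth X k ω with hB
  have hbm := measurable_birth hN.measurable_state
  have hcast : Measurable fun j : ℕ => (j : ℝ) := measurable_from_nat
  have hBm : ∀ k, Measurable (B k) := fun k => hcast.comp (hbm k)
  have hBindep : iIndepFun B P := hN.birth_indep.comp _ fun _ => hcast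
  have hBident : ∀ k, IdentDistrib (B k) (B 0) P P := fun k =>
    (identDistrib_of_range_zero_one (hbm k) (hbm 0) (birth_eq_zero_or_one X k)
      (birth_eq_zero_or_one X 0) ((hN.birth_law k).trans (hN.birth_law 0).symm)).comp hcast
  have hB01 : ∀ k ω, B k ω = 0 ∨ B k ω = 1 := fun k ω => by
    rcases birth_eq_zero_or_one X k ω with h | h <;> simp [hB, h]
  have hBL : MemLp (B 0) 2 P := MemLp.of_bound (hBm 0).aestronglyMeasurable 1
    (ae_of_all _ fun ω => by rcases hB01 0 ω with h | h <;> simp [h])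
  have hBmean : ∫ ω, B 0 ω ∂P = p := by
    have e : B 0 = Set.indicator {ω | birth X 0 ω = 1} 1 := by
      ext ω
      rcases birth_eq_zero_or_one X 0 ω with h | h <;> simp [hB, h]
    have hms : MeasurableSet {ω | birth X 0 ω = 1} := hbm 0 (measurableSet_singleton 1)
    rw [e, integral_indicator_one hms, hN.birth_law 0, hp, hθ]
  have hBvar : Var[B 0; P] = p * (1 - p) := by
    have e : B 0 ^ 2 = B 0 := by
      ext ω
      rcases hB01 0 ω with h | h <;> simp [h]
    rw [variance_eq_sub hBL, e, hBmean]
    ring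
  -- nonnegativity of the variance
  have hσ : 0 ≤ sigmaThetaSq α θ := by
    rw [sigmaThetaSq_eq hα, ← (hlin (θ * α) _).2.2]
    exact variance_nonneg _ _
  refine ⟨hσ, ?_⟩
  obtain ⟨g', hg, hg'⟩ := hasFDerivAt_birthRateFun p hα hθ0
  set a := p * θ * α with ha
  set b := -(p * θ * (3 * α ^ 2 * Real.log θ / (2 * Real.pi ^ 2))) with hb
  -- the three sample means
  set W : ℕ → Ω → ℝ × ℝ × ℝ := fun n ω => ((∑ k ∈ Finset.range n, B k ω) / n,
    (∑ k ∈ Finset.range n, V k ω) / n, (∑ k ∈ Finset.range n, V k ω ^ 2) / n) with hW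
  have hWm : ∀ n, Measurable (W n) := fun n => by fun_prop
  have hqm : Measurable fun x : ℝ => x ^ 2 := by fun_prop
  have hVL : MemLp (V 0) 2 P := by simpa using (hlin 1 0).1
  have hV2L : MemLp (fun ω => V 0 ω ^ 2) 2 P := by simpa using (hlin 0 1).1
  have hcheb : ∀ (n : ℕ) (K : ℝ), 0 < K → P.real {ω | K ≤ √n * ‖W n ω - (p, 0, κ)‖}
      ≤ (Var[B 0; P] + Var[V 0; P] + Var[fun ω => V 0 ω ^ 2; P]) / K ^ 2 := by
    intro n K hK
    have h1 := measureReal_le_sqrt_mul_abs_mean_sub_le hBL hBindep hBident n hK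
    have h2 := measureReal_le_sqrt_mul_abs_mean_sub_le hVL hVindep hVident n hK
    have h3 := measureReal_le_sqrt_mul_abs_mean_sub_le (Y := fun k ω => V k ω ^ 2) hV2L
      (hVindep.comp _ fun _ => hqm) (fun k => (hVident k).comp hqm) n hK
    rw [hBmean] at h1
    rw [m1] at h2
    rw [m2] at h3
    rw [add_div, add_div]
    refine (measureReal_mono fun ω hω => ?_).trans ((measureReal_union_le _ _).trans
      (add_le_add ((measureReal_union_le _ _).trans (add_le_add h1 h2)) h3))
    simp only [Set.mem_ofPred_eq, Set.mem_union, hW, Prod.norm_def, Prod.fst_sub, Prod.snd_sub,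
      Real.norm_eq_abs] at hω ⊢
    rw [mul_max_of_nonneg _ _ (Real.sqrt_nonneg _), mul_max_of_nonneg _ _ (Real.sqrt_nonneg _),
      le_max_iff, le_max_iff] at hω
    tauto
  -- the linear part
  have hfm : Measurable fun x : ℝ => a * x + b * x ^ 2 := by fun_prop
  obtain ⟨hξL, hξmean, hξvar⟩ := hlin a b
  have hA := tendstoInDistribution_sqrt_mul_mean_sub (Y := fun k ω => a * V k ω + b * V k ω ^ 2)
    hξL (hVindep.comp _ fun _ => hfm) fun k => (hVident k).comp hfm
  have hD := tendstoInDistribution_sqrt_mul_mean_sub (Y := fun k ω => θ * B k ω)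
    (hBL.const_mul θ) (hBindep.comp _ fun _ => measurable_const_mul θ)
    fun k => (hBident k).comp (measurable_const_mul θ)
  rw [integral_const_mul, hBmean, variance_const_mul, hBvar] at hD
  rw [hξmean, hξvar] at hA
  have hsum := tendstoInDistribution_add_gaussianReal hD hA fun n => by
    have := hN.time_birth_indep.symm.comp
      (φ := fun x : ℕ → ℕ => √(n : ℝ) * ((∑ k ∈ Finset.range n, θ * (x k : ℝ)) / n - θ * p))
      (ψ := fun x : ℕ → ℝ => √(n : ℝ) * ((∑ k ∈ Finset.range n,
        (a * (-Real.log (x k) - (Real.log θ / α + Real.eulerMascheroniConstant))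
        + b * (-Real.log (x k) - (Real.log θ / α + Real.eulerMascheroniConstant)) ^ 2)) / n - b * κ))
      (by fun_prop) (by fun_prop)
    exact this
  have hp1 : p ≤ 1 := by
    rw [hp, div_le_one hθ0, hθ]
    linarith
  have hp0 : 0 ≤ p := by rw [hp]; positivity
  have hvv : v.toNNReal = (θ ^ 2 * (p * (1 - p))).toNNReal
      + (a ^ 2 * κ + 2 * a * b * (2 * (riemannZeta 3).re) + b ^ 2 *
        (2 * Real.pi ^ 4 / (15 * α ^ 4) - Real.pi ^ 4 / 15 + 3 * κ ^ 2 - κ ^ 2)).toNNReal := by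
    rw [← Real.toNNReal_add, hv, sigmaThetaSq_eq hα, ha, hb]
    · congr 1
      ring
    · have := sub_nonneg.2 hp1
      positivity
    · rw [← hξvar]
      exact variance_nonneg _ _
  rw [← hvv] at hsum
  have hdelta := tendstoInDistribution_delta_method hg hcheb
    (hsum.congr (fun n => ae_of_all _ fun ω => ?_) EventuallyEq.rfl)
    fun n => ((measurable_birthRateFun _).comp (hWm n)).aemeasurable
  · refine hdelta.congr (fun n => ae_of_all _ fun ω => ?_) EventuallyEq.rfl
    rcases eq_or_ne n 0 with rfl | hn
    · simp
    · simp only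
      rw [lambdaHat_eq_birthRateFun S X (Real.log θ / α) hn ω V rfl,
        birthRateFun_apply p hα hθ0, hp, div_mul_cancel₀ _ hθ0.ne']
  · simp only [hW, Prod.mk_sub_mk, hg', Finset.sum_add_distrib, ← Finset.mul_sum]
    ring
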